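/- Let $A$ be a Banach algebra (not necessarily unital) over $\mathbb{R}$ or $\mathbb{C}$. For a Banach algebra $B$, the dual $B^*$ is a Banach $B$-bimodule via $\langle a\cdot f,b\rangle=\langle f,ba\rangle$, $\langle f\cdot a,b\rangle=\langle f,ab\rangle$, and $B^{**}$ is a Banach algebra under the first Arens product $\langle F\,\square\,G,f\rangle=\langle F,G\cdot f\rangle$, where $\langle G\cdot f,a\rangle=\langle G,f\cdot a\rangle$. Put $A^{(0)}=A$ and $A^{(2n+2)}=(A^{(2n)})^{**}$ with this product, and $A^{(2n+1)}=(A^{(2n)})^*$. We say that: * $B$ is an ideal in $B^{**}$ if $B\,\square\,B^{**}\subseteq B$ and $B^{**}\,\square\,B\subseteq B$, where $B$ is identified with its canonical image in $B^{**}$; * $B^*$ factors if $B^*=\{f\cdot a: f\in B^*,a\in B\}$ or $B^*=\{a\cdot f: a\in B, f\in B^*\}$; * $B$ is Arens regular if the first and second Arens products on $B^{**}$ coincide; * $B$ is weakly amenable if $H^1(B,B^*)=\{0\}$, i.e. every bounded linear $D:B\to B^*$ with $D(ab)=a\cdot D(b)+D(a)\cdot b$ is of the form $D(a)=a\cdot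 f-f\cdot a$ for some $f\in B^*$. $H^1_{w^*}(B^{**},B^{***})$ denotes the space of bounded derivations $B^{**}\to B^{***}$ that are continuous from $\sigma(B^{**},B^*)$ to $\sigma(B^{***},B^{**})$, modulo the inner ones. (1) For every $n\ge 0$: if $A^{(2n)}$ is an ideal in $A^{(2n+2)}$ and $A^{(2n+1)}$ factors, then $A^{(2n)}$ is Arens regular. (2) If $A^{**}$ is an ideal in $A^{****}$, $A^{***}$ factors and $A$ is weakly amenable, then $H^1_{w^*}(A^{**},A^{***})=\{0\}$. (3) For every $n\ge 0$: if $A^{(2n+2)}$ is an ideal in $A^{(2n+4)}$, $A^{(2n+3)}$ factors and $A^{(2n)}$ is weakly amenable, then $H^1_{w^*}(A^{(2n+2)},A^{(2n+3)})=\{0\}$. -/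

import Mathlib

set_option maxSynthPendingDepth 3

universe u

noncomputable section

namespace ArensDual

/-! ### Arens extensions of bounded bilinear maps -/

section Bilinear

variable {𝕜 X Y Z : Type*} [RCLike 𝕜]
  [NormedAddCommGroup X] [NormedSpace 𝕜 X] [NormedAddCommGroup Y] [NormedSpace 𝕜 Y]
  [NormedAddCommGroup Z] [NormedSpace 𝕜 Z]

/-- The adjoint `m* : Z* × X → Y*` of a bounded bilinear map `m : X × Y → Z`,
`⟨m*(z', x), y⟩ = ⟨z', m(x, y)⟩`. -/
def adj (m : X →L[𝕜] Y →L[𝕜] Z) : StrongDual 𝕜 Z →L[𝕜] X →L[𝕜] StrongDual 𝕜 Y :=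
  ((ContinuousLinearMap.compL 𝕜 X (Y →L[𝕜] Z) (Y →L[𝕜] 𝕜)).flip m).comp
    (ContinuousLinearMap.compL 𝕜 Y Z 𝕜)

@[simp] theorem adj_apply (m : X →L[𝕜] Y →L[𝕜] Z) (f : StrongDual 𝕜 Z) (x : X) (y : Y) :
    adj m f x y = f (m x y) := rfl

/-- The first Arens extension `m*** : X** × Y** → Z**`. -/
def firstExt (m : X →L[𝕜] Y →L[𝕜] Z) :
    StrongDual 𝕜 (StrongDual 𝕜 X) →L[𝕜] StrongDual 𝕜 (StrongDual 𝕜 Y) →L[𝕜]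
      StrongDual 𝕜 (StrongDual 𝕜 Z) :=
  adj (adj (adj m))

/-- The second Arens extension `m^{t***t} : X** × Y** → Z**`. -/
def secondExt (m : X →L[𝕜] Y →L[𝕜] Z) :
    StrongDual 𝕜 (StrongDual 𝕜 X) →L[𝕜] StrongDual 𝕜 (StrongDual 𝕜 Y) →L[𝕜]
      StrongDual 𝕜 (StrongDual 𝕜 Z) :=
  (firstExt m.flip).flip

/-- A bounded bilinear map is Arens regular if its two Arens extensions coincide. -/
def IsArensRegularMap (m : X →L[𝕜] Y →L[𝕜] Z) : Prop := firstExt m = secondExt m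

end Bilinear

/-! ### The second dual of a Banach algebra -/

/-- The second dual `A**` of `A`, with the dual norm. If `A` is a normed algebra, it carries the
first Arens product (instance below). -/
def Bidual (𝕜 A : Type*) [RCLike 𝕜] [NormedAddCommGroup A] [NormedSpace 𝕜 A] : Type _ :=
  StrongDual 𝕜 (StrongDual 𝕜 A)

section BidualSpace

variable (𝕜 A : Type*) [RCLike 𝕜] [NormedAddCommGroup A] [NormedSpace 𝕜 A]

instance : NormedAddCommGroup (Bidual 𝕜 A) :=
  inferInstanceAs (NormedAddCommGroup (StrongDual 𝕜 (StrongDual 𝕜 A)))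

instance : NormedSpace 𝕜 (Bidual 𝕜 A) :=
  inferInstanceAs (NormedSpace 𝕜 (StrongDual 𝕜 (StrongDual 𝕜 A)))

instance : CompleteSpace (Bidual 𝕜 A) :=
  inferInstanceAs (CompleteSpace (StrongDual 𝕜 (StrongDual 𝕜 A)))

/-- Elements of `A**` are functionals on `A*`. -/
instance : FunLike (Bidual 𝕜 A) (StrongDual 𝕜 A) 𝕜 :=
  inferInstanceAs (FunLike (StrongDual 𝕜 (StrongDual 𝕜 A)) (StrongDual 𝕜 A) 𝕜)

/-- The identity, from the dual space of `A*` to `A**`. -/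
def toBidual : StrongDual 𝕜 (StrongDual 𝕜 A) ≃ₗᵢ[𝕜] Bidual 𝕜 A :=
  LinearIsometryEquiv.refl 𝕜 (StrongDual 𝕜 (StrongDual 𝕜 A))

@[simp] theorem toBidual_apply (F : StrongDual 𝕜 (StrongDual 𝕜 A)) (f : StrongDual 𝕜 A) :
    toBidual 𝕜 A F f = F f := rfl

/-- The canonical embedding `A → A**`. -/
def incl : A →L[𝕜] Bidual 𝕜 A := NormedSpace.inclusionInDoubleDual 𝕜 A

@[simp] theorem incl_apply (a : A) (f : StrongDual 𝕜 A) : incl 𝕜 A a f = f a := rfl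

end BidualSpace

section Algebra

variable (𝕜 A : Type*) [RCLike 𝕜] [NonUnitalNormedRing A] [NormedSpace 𝕜 A]
  [IsScalarTower 𝕜 A A] [SMulCommClass 𝕜 A A]

/-- The first Arens product on `A**`, the first Arens extension of the multiplication of `A`. -/
instance : Mul (Bidual 𝕜 A) := ⟨fun F G => firstExt (ContinuousLinearMap.mul 𝕜 A) F G⟩

variable {𝕜 A}

theorem bidual_mul_def (F G : Bidual 𝕜 A) :
    F * G = firstExt (ContinuousLinearMap.mul 𝕜 A) F G := rfl

theorem bidual_mul_assoc (F G H : Bidual 𝕜 A) : F * G * H = F * (G * H) := by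
  have h1 : ∀ (f : StrongDual 𝕜 A) (a : A),
      adj (adj (ContinuousLinearMap.mul 𝕜 A)) H (adj (ContinuousLinearMap.mul 𝕜 A) f a)
        = adj (ContinuousLinearMap.mul 𝕜 A)
            (adj (adj (ContinuousLinearMap.mul 𝕜 A)) H f) a := by
    intro f a
    refine ContinuousLinearMap.ext fun b => ?_
    simp only [adj_apply]
    refine congrArg _ (ContinuousLinearMap.ext fun c => ?_)
    simp [mul_assoc]
  refine ContinuousLinearMap.ext (f := F * G * H) (g := F * (G * H)) fun f => ?_
  exact congrArg F (ContinuousLinearMap.ext fun a => congrArg G (h1 f a).symm)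

theorem bidual_norm_mul_le (F G : Bidual 𝕜 A) : ‖F * G‖ ≤ ‖F‖ * ‖G‖ := by
  refine ContinuousLinearMap.opNorm_le_bound _ (by positivity) fun f => ?_
  rw [mul_assoc]
  refine (ContinuousLinearMap.le_opNorm F _).trans ?_
  refine mul_le_mul_of_nonneg_left ?_ (norm_nonneg _)
  refine ContinuousLinearMap.opNorm_le_bound _ (by positivity) fun a => ?_
  rw [mul_assoc]
  refine (ContinuousLinearMap.le_opNorm G _).trans ?_
  refine mul_le_mul_of_nonneg_left ?_ (norm_nonneg _)
  refine ContinuousLinearMap.opNorm_le_bound _ (by positivity) fun b => ?_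
  rw [mul_assoc]
  exact (ContinuousLinearMap.le_opNorm f _).trans
    (mul_le_mul_of_nonneg_left (norm_mul_le a b) (norm_nonneg _))

instance : NonUnitalNormedRing (Bidual 𝕜 A) where
  toNorm := inferInstance
  toAddCommGroup := inferInstance
  toMul := inferInstance
  toMetricSpace := inferInstance
  dist_eq := dist_eq_norm_neg_add
  left_distrib F G H := map_add (firstExt (ContinuousLinearMap.mul 𝕜 A) F) G H
  right_distrib F G H := by
    simp only [bidual_mul_def]
    exact DFunLike.congr_fun (map_add (firstExt (ContinuousLinearMap.mul 𝕜 A)) F G) H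
  zero_mul F := DFunLike.congr_fun (map_zero (firstExt (ContinuousLinearMap.mul 𝕜 A))) F
  mul_zero F := map_zero (firstExt (ContinuousLinearMap.mul 𝕜 A) F)
  mul_assoc := bidual_mul_assoc
  norm_mul_le := bidual_norm_mul_le

instance : IsScalarTower 𝕜 (Bidual 𝕜 A) (Bidual 𝕜 A) where
  smul_assoc c F G :=
    DFunLike.congr_fun (map_smul (firstExt (ContinuousLinearMap.mul 𝕜 A)) c F) G

instance : SMulCommClass 𝕜 (Bidual 𝕜 A) (Bidual 𝕜 A) where
  smul_comm c F G := (map_smul (firstExt (ContinuousLinearMap.mul 𝕜 A) F) c G).symm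

/-! ### The dual bimodule, factorization, ideals, Arens regularity -/

/-- The left action of `A` on `A*`: `⟨a · f, b⟩ = ⟨f, b a⟩`. -/
def lact (a : A) (f : StrongDual 𝕜 A) : StrongDual 𝕜 A :=
  f.comp ((ContinuousLinearMap.mul 𝕜 A).flip a)

/-- The right action of `A` on `A*`: `⟨f · a, b⟩ = ⟨f, a b⟩`. -/
def ract (f : StrongDual 𝕜 A) (a : A) : StrongDual 𝕜 A :=
  f.comp (ContinuousLinearMap.mul 𝕜 A a)

@[simp] theorem lact_apply (a : A) (f : StrongDual 𝕜 A) (b : A) : lact a f b = f (b * a) := rfl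

@[simp] theorem ract_apply (f : StrongDual 𝕜 A) (a : A) (b : A) : ract f a b = f (a * b) := rfl

variable (𝕜 A)

/-- `A` is a two-sided ideal in `A**` (through the canonical embedding). -/
def IsIdealInBidual : Prop :=
  ∀ (a : A) (F : Bidual 𝕜 A),
    incl 𝕜 A a * F ∈ Set.range (incl 𝕜 A) ∧ F * incl 𝕜 A a ∈ Set.range (incl 𝕜 A)

/-- `A*` factors on the left: `A* = A* A`. -/
def DualFactorsLeft : Prop := ∀ f : StrongDual 𝕜 A, ∃ (g : StrongDual 𝕜 A) (a : A), f = ract g a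

/-- `A*` factors on the right: `A* = A A*`. -/
def DualFactorsRight : Prop := ∀ f : StrongDual 𝕜 A, ∃ (a : A) (g : StrongDual 𝕜 A), f = lact a g

/-- `A*` factors, on at least one side. -/
def DualFactors : Prop := DualFactorsLeft 𝕜 A ∨ DualFactorsRight 𝕜 A

/-- `A` is Arens regular. -/
def IsArensRegular : Prop := IsArensRegularMap (ContinuousLinearMap.mul 𝕜 A)

/-! ### Derivations into the dual and first cohomology groups -/

/-- `Z¹(A, A*)`: bounded linear `D : A → A*` with `D(ab) = a · D(b) + D(a) · b`. -/
def Z1 : Submodule 𝕜 (A →L[𝕜] StrongDual 𝕜 A) where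
  carrier := {D | ∀ a b : A, D (a * b) = lact a (D b) + ract (D a) b}
  zero_mem' := by
    intro a b
    ext c
    simp
  add_mem' := by
    intro D E hD hE a b
    ext c
    simp [hD a b, hE a b]
    ring
  smul_mem' := by
    intro k D hD a b
    ext c
    simp [hD a b]

variable {𝕜 A}

/-- The inner derivation `δ_f(a) = a · f - f · a`. -/
def innerDer (f : StrongDual 𝕜 A) : A →L[𝕜] StrongDual 𝕜 A :=
  adj (ContinuousLinearMap.mul 𝕜 A).flip f - adj (ContinuousLinearMap.mul 𝕜 A) f

theorem innerDer_apply (f : StrongDual 𝕜 A) (a : A) : innerDer f a = lact a f - ract f a := rfl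

variable (𝕜 A)

/-- `B¹(A, A*)`: the inner derivations. -/
def B1 : Submodule 𝕜 (A →L[𝕜] StrongDual 𝕜 A) where
  carrier := Set.range innerDer
  zero_mem' := ⟨0, by simp [innerDer]⟩
  add_mem' := by
    rintro _ _ ⟨f, rfl⟩ ⟨g, rfl⟩
    exact ⟨f + g, by simp [innerDer]; abel⟩
  smul_mem' := by
    rintro k _ ⟨f, rfl⟩
    exact ⟨k • f, by simp [innerDer, smul_sub]⟩

theorem B1_le_Z1 : B1 𝕜 A ≤ Z1 𝕜 A := by
  rintro _ ⟨f, rfl⟩ a b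
  ext c
  simp [innerDer_apply, mul_assoc]

/-- `H¹(A, A*) = Z¹(A, A*) / B¹(A, A*)`. -/
abbrev H1 : Type _ := Z1 𝕜 A ⧸ (B1 𝕜 A).submoduleOf (Z1 𝕜 A)

/-- `A` is weakly amenable: `H¹(A, A*) = {0}`. -/
def IsWeaklyAmenable : Prop := Subsingleton (H1 𝕜 A)

/-- Weak*-weak* continuity of a map `A** → A***`: from `σ(A**, A*)` to `σ(A***, A**)`. -/
def IsWeakStarContinuous (D : Bidual 𝕜 A →L[𝕜] StrongDual 𝕜 (Bidual 𝕜 A)) : Prop :=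
  Continuous fun F : WeakDual 𝕜 (StrongDual 𝕜 A) =>
    StrongDual.toWeakDual (D (toBidual 𝕜 A (WeakDual.toStrongDual F)))

/-- `Z¹_{w*}(A**, A***)`: the weak*-weak* continuous derivations `A** → A***`. -/
def Z1WeakStar : Submodule 𝕜 (Bidual 𝕜 A →L[𝕜] StrongDual 𝕜 (Bidual 𝕜 A)) where
  carrier := {D | D ∈ Z1 𝕜 (Bidual 𝕜 A) ∧ IsWeakStarContinuous 𝕜 A D}
  zero_mem' := ⟨Submodule.zero_mem _, continuous_const⟩
  add_mem' := fun hD hE => ⟨Submodule.add_mem _ hD.1 hE.1, Continuous.add hD.2 hE.2⟩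
  smul_mem' := fun k _ hD => ⟨Submodule.smul_mem _ k hD.1, Continuous.const_smul hD.2 k⟩

/-- `H¹_{w*}(A**, A***)`: weak*-weak* continuous derivations modulo inner ones. -/
abbrev H1WeakStar : Type _ :=
  Z1WeakStar 𝕜 A ⧸ (B1 𝕜 (Bidual 𝕜 A)).submoduleOf (Z1WeakStar 𝕜 A)

end Algebra

/-! ### The even iterated duals -/

/-- Bundled Banach algebras over `𝕜` (not necessarily unital), used to iterate `A ↦ A**`. -/
structure BanachAlg (𝕜 : Type) [RCLike 𝕜] : Type (u + 1) where
  /-- The underlying type. -/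
  carrier : Type u
  [ring : NonUnitalNormedRing carrier]
  [space : NormedSpace 𝕜 carrier]
  [tower : IsScalarTower 𝕜 carrier carrier]
  [comm : SMulCommClass 𝕜 carrier carrier]
  [complete : CompleteSpace carrier]

attribute [instance] BanachAlg.ring BanachAlg.space BanachAlg.tower BanachAlg.comm
  BanachAlg.complete

/-- The even dual `A^{(2n)}`: `A^{(0)} = A` and `A^{(2n+2)} = (A^{(2n)})**` with the first Arens
product. -/
def evenDualBundled {𝕜 : Type} [RCLike 𝕜] (A : BanachAlg.{u} 𝕜) : ℕ → BanachAlg.{u} 𝕜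
  | 0 => A
  | n + 1 => ⟨Bidual 𝕜 (evenDualBundled A n).carrier⟩

/-- The Banach algebra `A^{(2n)}`. -/
abbrev EvenDual (𝕜 : Type) (A : Type u) [RCLike 𝕜] [NonUnitalNormedRing A] [NormedSpace 𝕜 A]
    [IsScalarTower 𝕜 A A] [SMulCommClass 𝕜 A A] [CompleteSpace A] (n : ℕ) : Type u :=
  (evenDualBundled (BanachAlg.mk A : BanachAlg.{u} 𝕜) n).carrier

end ArensDual

end

/-!
Throughout, `B` is a Banach algebra and `i : B → B**` the canonical embedding, a homomorphism.

*Arens regularity.* If `B` is an ideal in `B**`, then for `f = g · a` both Arens products of `F` and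
`G` take at `f` the value `⟨G, g · (a □ F)⟩`, where `a □ F ∈ B`; the case `f = a · g` is symmetric.
So the two products agree as soon as every functional on `B` has such a form
(`isArensRegular_of_ideal_of_factors`).

*Derivations.* Suppose `A**` is an ideal in `A****`, `A***` factors and `A` is weakly amenable. By
the first part `A**` is Arens regular. Both hypotheses descend to `A`: regularity because `A` is a
subalgebra of `A**` (`isArensRegular_of_bidual`), and the ideal property because `i**(a □ F)` is a
product of `i** F` with an element of `A**`, hence lies in `A**`, which by Hahn–Banach forces
`a □ F ∈ A` (`isIdealInBidual_of_bidual`).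

Given a weak*-continuous derivation `D : A** → A***`, weak amenability provides `f ∈ A*` with
`⟨D a, b⟩ = ⟨a · f - f · a, b⟩` for `a, b ∈ A`. Put `E = D - δ_f`, with `f` regarded as an element
of `A***`. Then `⟨E a, b⟩ = 0` on `A`, so, `A` being an ideal in `A**`,
`⟨E (a b), G⟩ = ⟨E b, G □ a⟩ + ⟨E a, b □ G⟩ = 0` for every `G ∈ A**`. In a weakly amenable algebra a
functional that vanishes on all products is zero (`eq_zero_of_mul_eq_zero`), whence `E = 0` on `A`.
Finally `F ↦ ⟨D F, G⟩` is weak*-continuous by hypothesis, `F ↦ ⟨δ_f F, G⟩` by Arens regularity of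
`A`, so both are determined by their values on `A` and `D = δ_f`.
-/

namespace ArensDual

noncomputable section

variable {𝕜 A : Type*} [RCLike 𝕜]

/-! ### Functionals on a second dual -/

section Space

variable [NormedAddCommGroup A] [NormedSpace 𝕜 A]

theorem bidual_ext {F G : Bidual 𝕜 A} (h : ∀ f : StrongDual 𝕜 A, F f = G f) : F = G :=
  ContinuousLinearMap.ext (f := F) (g := G) h

theorem exists_dual_ne_zero_of_notMem {p : Submodule 𝕜 A} (hp : IsClosed (p : Set A)) {x : A}
    (hx : x ∉ p) : ∃ φ : StrongDual 𝕜 A, (∀ y ∈ p, φ y = 0) ∧ φ x ≠ 0 := by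
  have : IsClosed (p : Set A) := hp
  have hne : p.mkQL x ≠ 0 := fun h => hx ((Submodule.Quotient.mk_eq_zero p).1 h)
  obtain ⟨ψ, hψ⟩ := SeparatingDual.exists_ne_zero (R := 𝕜) hne
  refine ⟨ψ.comp p.mkQL, fun y hy => ?_, hψ⟩
  have : p.mkQL y = 0 := (Submodule.Quotient.mk_eq_zero p).2 hy
  simp [this]

/-- The image of a Banach space in its second dual is closed, hence it is the annihilator of its
annihilator. -/
theorem mem_range_incl [CompleteSpace A] {H : Bidual 𝕜 A}
    (h : ∀ φ : StrongDual 𝕜 (Bidual 𝕜 A), φ.comp (incl 𝕜 A) = 0 → φ H = 0) :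
    H ∈ Set.range (incl 𝕜 A) := by
  have hiso : Isometry (incl 𝕜 A) :=
    (NormedSpace.inclusionInDoubleDualLi (E := A) 𝕜).isometry
  by_contra hH
  obtain ⟨φ, hφ, hφH⟩ := exists_dual_ne_zero_of_notMem (𝕜 := 𝕜)
    (p := (incl 𝕜 A : A →ₗ[𝕜] Bidual 𝕜 A).range) (x := H)
    hiso.isClosedEmbedding.isClosed_range (by simpa using hH)
  exact hφH (h φ (ContinuousLinearMap.ext fun a => hφ _ ⟨a, rfl⟩))

/-- A functional `f` on `A`, seen as the functional `F ↦ ⟨F, f⟩` on `A**`. -/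
def evalAt (f : StrongDual 𝕜 A) : StrongDual 𝕜 (Bidual 𝕜 A) :=
  (ContinuousLinearMap.apply 𝕜 𝕜 f).comp
    ((toBidual 𝕜 A).symm.toContinuousLinearEquiv :
      Bidual 𝕜 A →L[𝕜] StrongDual 𝕜 (StrongDual 𝕜 A))

@[simp] theorem evalAt_apply (f : StrongDual 𝕜 A) (F : Bidual 𝕜 A) : evalAt f F = F f := rfl

/-- The second adjoint `i** : A** → A****` of the canonical embedding `i : A → A**`. -/
def biincl (F : Bidual 𝕜 A) : Bidual 𝕜 (Bidual 𝕜 A) :=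
  toBidual 𝕜 (Bidual 𝕜 A) (((toBidual 𝕜 A).symm F).comp
    ((ContinuousLinearMap.compL 𝕜 A (Bidual 𝕜 A) 𝕜).flip (incl 𝕜 A)))

theorem biincl_apply (F : Bidual 𝕜 A) (φ : StrongDual 𝕜 (Bidual 𝕜 A)) :
    biincl F φ = F (φ.comp (incl 𝕜 A)) := rfl

/-- If `i** H` lies in the image of `A**`, then it is the image of `H`, and `i** H` kills the
annihilator of `A`. -/
theorem mem_range_incl_of_biincl_mem [CompleteSpace A] {H : Bidual 𝕜 A}
    (h : biincl H ∈ Set.range (incl 𝕜 (Bidual 𝕜 A))) : H ∈ Set.range (incl 𝕜 A) := by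
  obtain ⟨K, hK⟩ := h
  have hφ (φ : StrongDual 𝕜 (Bidual 𝕜 A)) : φ K = H (φ.comp (incl 𝕜 A)) :=
    DFunLike.congr_fun hK φ
  have hKH : K = H := bidual_ext fun f => hφ (evalAt f)
  subst hKH
  refine mem_range_incl fun φ h0 => ?_
  rw [hφ, h0]
  exact map_zero ((toBidual 𝕜 A).symm K)

/-- A weak*-continuous linear functional on `A**` is evaluation at an element of `A*`, hence is
determined by its values on `A`. -/
theorem apply_eq_of_isWeakStarContinuous {D : Bidual 𝕜 A →L[𝕜] StrongDual 𝕜 (Bidual 𝕜 A)}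
    (hD : Continuous fun F : WeakDual 𝕜 (StrongDual 𝕜 A) =>
      StrongDual.toWeakDual (D (toBidual 𝕜 A (WeakDual.toStrongDual F)))) (F G : Bidual 𝕜 A) :
    D F G = F ((D.flip G).comp (incl 𝕜 A)) := by
  let ψ : StrongDual 𝕜 (WeakBilin (topDualPairing 𝕜 (StrongDual 𝕜 A))) :=
    { toFun := fun F => D (F : StrongDual 𝕜 (StrongDual 𝕜 A)) G
      map_add' := fun F F' => DFunLike.congr_fun (map_add D F F') G
      map_smul' := fun c F => DFunLike.congr_fun (map_smul D c F) G
      cont := (WeakDual.eval_continuous G).comp hD }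
  obtain ⟨f, hf⟩ := LinearMap.dualEmbedding_surjective _ ψ
  have hψ (F : Bidual 𝕜 A) : D F G = F f := (DFunLike.congr_fun hf F).symm
  have : (D.flip G).comp (incl 𝕜 A) = f := ContinuousLinearMap.ext fun a => hψ (incl 𝕜 A a)
  rw [this, hψ]

end Space

/-! ### The two Arens products -/

section Products

variable [NonUnitalNormedRing A] [NormedSpace 𝕜 A] [IsScalarTower 𝕜 A A] [SMulCommClass 𝕜 A A]

/-- The functional `a ↦ ⟨G, f · a⟩`, that is `G · f`. -/
def bilact (G : Bidual 𝕜 A) (f : StrongDual 𝕜 A) : StrongDual 𝕜 A :=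
  adj (adj (ContinuousLinearMap.mul 𝕜 A)) G f

/-- The functional `a ↦ ⟨F, a · f⟩`, that is `f · F` for the second Arens product. -/
def biract (F : Bidual 𝕜 A) (f : StrongDual 𝕜 A) : StrongDual 𝕜 A :=
  adj (adj (ContinuousLinearMap.mul 𝕜 A).flip) F f

theorem biract_apply (F : Bidual 𝕜 A) (f : StrongDual 𝕜 A) (a : A) :
    biract F f a = F (lact a f) := rfl

variable (𝕜 A) in
theorem isArensRegular_iff : IsArensRegular 𝕜 A ↔
    ∀ (F G : Bidual 𝕜 A) (f : StrongDual 𝕜 A), F (bilact G f) = G (biract F f) := by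
  constructor
  · intro h F G f
    exact DFunLike.congr_fun (DFunLike.congr_fun (DFunLike.congr_fun h F) G) f
  · intro h
    exact ContinuousLinearMap.ext fun F => ContinuousLinearMap.ext fun G =>
      ContinuousLinearMap.ext fun f => h F G f

theorem isArensRegular_of_ideal_of_factors (hI : IsIdealInBidual 𝕜 A) (hF : DualFactors 𝕜 A) :
    IsArensRegular 𝕜 A := by
  refine (isArensRegular_iff 𝕜 A).2 fun F G f => ?_
  rcases hF with hF | hF
  · obtain ⟨g, a, rfl⟩ := hF f
    obtain ⟨b, hb⟩ := (hI a F).1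
    -- Both sides are `⟨G, g · b⟩`, where `b = a □ F`.
    have h1 : F (bilact G (ract g a)) = G (ract g b) :=
      calc F (bilact G (ract g a)) = (incl 𝕜 A a * (F * G)) g := rfl
        _ = (incl 𝕜 A b * G) g := by rw [← mul_assoc, hb]
        _ = G (ract g b) := rfl
    have h2 : biract F (ract g a) = ract g b := by
      ext c
      calc biract F (ract g a) c = F (lact c (ract g a)) := rfl
        _ = F (ract (lact c g) a) := by
          congr 1; ext d; simp [mul_assoc]
        _ = (incl 𝕜 A a * F) (lact c g) := rfl
        _ = ract g b c := by rw [← hb]; rfl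
    rw [h1, h2]
  · obtain ⟨a, g, rfl⟩ := hF f
    obtain ⟨b, hb⟩ := (hI a G).2
    -- Both sides are `⟨F, b · g⟩`, where `b = G □ a`.
    have h1 : F (bilact G (lact a g)) = F (lact b g) := by
      congr 1
      ext c
      calc bilact G (lact a g) c = G (ract (lact a g) c) := rfl
        _ = G (lact a (ract g c)) := by
          congr 1; ext d; simp [mul_assoc]
        _ = (G * incl 𝕜 A a) (ract g c) := rfl
        _ = lact b g c := by rw [← hb]; rfl
    have h2 : G (biract F (lact a g)) = F (lact b g) :=
      calc G (biract F (lact a g)) = G (lact a (biract F g)) := by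
            congr 1; ext c
            rw [biract_apply, lact_apply, biract_apply]
            congr 1; ext d; simp [mul_assoc]
        _ = (G * incl 𝕜 A a) (biract F g) := rfl
        _ = F (lact b g) := by rw [← hb]; rfl
    rw [h1, h2]

/-! ### Passing from the second dual to the algebra -/

/-- A subalgebra of an Arens regular algebra is Arens regular, in the case of `A` in `A**`. -/
theorem isArensRegular_of_bidual (h : IsArensRegular 𝕜 (Bidual 𝕜 A)) : IsArensRegular 𝕜 A :=
  (isArensRegular_iff 𝕜 A).2 fun F G f =>
    (isArensRegular_iff 𝕜 (Bidual 𝕜 A)).1 h (biincl F) (biincl G) (evalAt f)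

theorem isIdealInBidual_of_bidual [CompleteSpace A] (h : IsIdealInBidual 𝕜 (Bidual 𝕜 A)) :
    IsIdealInBidual 𝕜 A := by
  intro a F
  have h1 : biincl (incl 𝕜 A a * F) = incl 𝕜 (Bidual 𝕜 A) (incl 𝕜 A a) * biincl F := rfl
  have h2 : biincl (F * incl 𝕜 A a) = biincl F * incl 𝕜 (Bidual 𝕜 A) (incl 𝕜 A a) := rfl
  exact ⟨mem_range_incl_of_biincl_mem (h1 ▸ (h _ _).1),
    mem_range_incl_of_biincl_mem (h2 ▸ (h _ _).2)⟩

/-! ### Weak amenability and weak*-continuous derivations -/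

theorem IsWeaklyAmenable.exists_eq_innerDer (h : IsWeaklyAmenable 𝕜 A)
    {D : A →L[𝕜] StrongDual 𝕜 A} (hD : D ∈ Z1 𝕜 A) : ∃ f, D = innerDer f := by
  have htop := Submodule.Quotient.subsingleton_iff.1 h
  have hmem : (⟨D, hD⟩ : Z1 𝕜 A) ∈ (B1 𝕜 A).submoduleOf (Z1 𝕜 A) := htop ▸ Submodule.mem_top
  obtain ⟨f, hf⟩ := hmem
  exact ⟨f, hf.symm⟩

/-- In a weakly amenable algebra the products span a dense subspace: a functional `f` that kills
them gives the derivation `a ↦ ⟨f, a⟩ f`, and `⟨a · g - g · a, a⟩ = 0` for every `g`. -/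
theorem eq_zero_of_mul_eq_zero (h : IsWeaklyAmenable 𝕜 A) {f : StrongDual 𝕜 A}
    (hf : ∀ a b, f (a * b) = 0) : f = 0 := by
  have hZ : f.smulRight f ∈ Z1 𝕜 A := by
    intro a b
    ext c
    simp [hf]
  obtain ⟨g, hg⟩ := h.exists_eq_innerDer hZ
  ext a
  have := DFunLike.congr_fun (DFunLike.congr_fun hg a) a
  simpa [innerDer_apply] using this

/-- If `A` is Arens regular, the inner derivation of `A**` given by `f ∈ A*` is determined on `A**`
by its values on `A`. -/
theorem innerDer_evalAt_apply (h : IsArensRegular 𝕜 A) (f : StrongDual 𝕜 A) (F G : Bidual 𝕜 A) :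
    innerDer (evalAt f) F G = F (((innerDer (evalAt f)).flip G).comp (incl 𝕜 A)) := by
  have h1 : ((innerDer (evalAt f)).flip G).comp (incl 𝕜 A) = biract G f - bilact G f := rfl
  have h2 : innerDer (evalAt f) F G = G (bilact F f) - F (bilact G f) := rfl
  rw [h1, h2, (isArensRegular_iff 𝕜 A).1 h G F f]
  exact (map_sub ((toBidual 𝕜 A).symm F) _ _).symm

/-- A derivation `E : A** → A***` with `⟨E a, b⟩ = 0` for `a, b ∈ A` vanishes on `A`. -/
theorem derivation_incl_eq_zero (hI : IsIdealInBidual 𝕜 A) (hW : IsWeaklyAmenable 𝕜 A)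
    {E : Bidual 𝕜 A →L[𝕜] StrongDual 𝕜 (Bidual 𝕜 A)} (hE : E ∈ Z1 𝕜 (Bidual 𝕜 A))
    (h0 : ∀ a b, E (incl 𝕜 A a) (incl 𝕜 A b) = 0) (a : A) : E (incl 𝕜 A a) = 0 := by
  ext G
  refine DFunLike.congr_fun
    (eq_zero_of_mul_eq_zero hW (f := (E.flip G).comp (incl 𝕜 A)) fun a b => ?_) a
  obtain ⟨c, hc⟩ := (hI a G).2
  obtain ⟨d, hd⟩ := (hI b G).1
  calc E (incl 𝕜 A (a * b)) G = E (incl 𝕜 A a * incl 𝕜 A b) G := rfl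
    _ = E (incl 𝕜 A b) (G * incl 𝕜 A a) + E (incl 𝕜 A a) (incl 𝕜 A b * G) := by
      rw [hE]; rfl
    _ = 0 := by rw [← hc, ← hd, h0, h0, add_zero]

/-- The restriction to `A` of a derivation `A** → A***`, followed by the restriction of functionals
from `A**` to `A`, is a derivation. -/
theorem restrict_mem_Z1 {D : Bidual 𝕜 A →L[𝕜] StrongDual 𝕜 (Bidual 𝕜 A)}
    (hD : D ∈ Z1 𝕜 (Bidual 𝕜 A)) :
    ((ContinuousLinearMap.compL 𝕜 A (Bidual 𝕜 A) 𝕜).flip (incl 𝕜 A)).comp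
      (D.comp (incl 𝕜 A)) ∈ Z1 𝕜 A := fun a b =>
  ContinuousLinearMap.ext fun c =>
    DFunLike.congr_fun (hD (incl 𝕜 A a) (incl 𝕜 A b)) (incl 𝕜 A c)

theorem subsingleton_H1WeakStar [CompleteSpace A] (hI : IsIdealInBidual 𝕜 (Bidual 𝕜 A))
    (hF : DualFactors 𝕜 (Bidual 𝕜 A)) (hW : IsWeaklyAmenable 𝕜 A) :
    Subsingleton (H1WeakStar 𝕜 A) := by
  have hR : IsArensRegular 𝕜 A :=
    isArensRegular_of_bidual (isArensRegular_of_ideal_of_factors hI hF)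
  refine Submodule.Quotient.subsingleton_iff.2 (eq_top_iff.2 ?_)
  rintro ⟨D, hD, hDc⟩ -
  obtain ⟨f, hf⟩ := hW.exists_eq_innerDer (restrict_mem_Z1 hD)
  have hE : D - innerDer (evalAt f) ∈ Z1 𝕜 (Bidual 𝕜 A) :=
    Submodule.sub_mem _ hD (B1_le_Z1 𝕜 _ ⟨_, rfl⟩)
  have h0 := derivation_incl_eq_zero (isIdealInBidual_of_bidual hI) hW hE fun a b =>
    sub_eq_zero.2 (DFunLike.congr_fun (DFunLike.congr_fun hf a) b)
  refine ⟨evalAt f, ContinuousLinearMap.ext fun F => ContinuousLinearMap.ext fun G => ?_⟩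
  change innerDer (evalAt f) F G = D F G
  rw [apply_eq_of_isWeakStarContinuous hDc, innerDer_evalAt_apply hR]
  congr 1
  ext a
  exact (DFunLike.congr_fun (sub_eq_zero.1 (h0 a)) G).symm

end Products

end

end ArensDual

theorem mainTheorem8 {𝕜 : Type} [RCLike 𝕜] {A : Type u} [NonUnitalNormedRing A]
    [NormedSpace 𝕜 A] [IsScalarTower 𝕜 A A] [SMulCommClass 𝕜 A A] [CompleteSpace A] :
    (∀ n : ℕ, ArensDual.IsIdealInBidual 𝕜 (ArensDual.EvenDual 𝕜 A n) →
      ArensDual.DualFactors 𝕜 (ArensDual.EvenDual 𝕜 A n) →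
      ArensDual.IsArensRegular 𝕜 (ArensDual.EvenDual 𝕜 A n)) ∧
    (ArensDual.IsIdealInBidual 𝕜 (ArensDual.Bidual 𝕜 A) →
      ArensDual.DualFactors 𝕜 (ArensDual.Bidual 𝕜 A) →
      ArensDual.IsWeaklyAmenable 𝕜 A →
      Subsingleton (ArensDual.H1WeakStar 𝕜 A)) ∧
    (∀ n : ℕ, ArensDual.IsIdealInBidual 𝕜 (ArensDual.EvenDual 𝕜 A (n + 1)) →
      ArensDual.DualFactors 𝕜 (ArensDual.EvenDual 𝕜 A (n + 1)) →
      ArensDual.IsWeaklyAmenable 𝕜 (ArensDual.EvenDual 𝕜 A n) →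
      Subsingleton (ArensDual.H1WeakStar 𝕜 (ArensDual.EvenDual 𝕜 A n))) := by
  refine ⟨fun n => ArensDual.isArensRegular_of_ideal_of_factors,
    ArensDual.subsingleton_H1WeakStar, fun n => ?_⟩
  exact ArensDual.subsingleton_H1WeakStar (A := ArensDual.EvenDual 𝕜 A n)
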